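/- A meromorphic inner function (MIF) is a bounded analytic function $\Theta$ on the upper half-plane $\mathbb C_+$ which has a meromorphic continuation to $\mathbb C$, also denoted by $\Theta$, with $|\Theta|=1$ almost everywhere on $\mathbb R$. Its spectrum is the set $\{x\in\mathbb R:\Theta(x)=1\}$. A sequence $\{s_n\}$ of real numbers, indexed by any set (one-sided or two-sided sequences, for example), is separated if there is $\varepsilon>0$ with $|s_n-s_m|>\varepsilon$ for all $n\neq m$. Let $\{s_n\}$ be a separated sequence of real numbers and let $D>0$ be a constant such that, for every integer $N\ge 2$, there are points $t_1<t_2<\dots<t_N$ with $[t_1,t_N]\cap\{s_m\}=\{t_1,\dots,t_N\}$, with $t_2-t_1>ND$, and with $t_{n+1}-t_n<D$ for all $2\le n\le N-1$. Let $\Theta$ be any MIF whose spectrum is $\{s_n\}$. Then for every $\delta>0$ there is a zero $z=x+iy$ of $\Theta$ with $0<y<\delta$. Moreover, $|\Theta'|$ is unbounded on $\mathbb R$. -/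

import Mathlib

open Set MeasureTheory

/-- A meromorphic inner function on the upper half-plane, given through its meromorphic continuation
`Θ` to the plane: `Θ` is analytic and bounded on the open upper half-plane and has modulus one
almost everywhere on the real line.
Meromorphic functions are taken in normal form, so that `Θ` takes its true values at every point
which is not a pole; since `Θ` is bounded on the upper half-plane, it has no real poles, so it is
analytic at every real point and its boundary values on the real line are the numbers `Θ x`. -/
structure IsMeromorphicInner (Θ : ℂ → ℂ) : Prop where
  meromorphicNFOn : MeromorphicNFOn Θ univ
  differentiableOn : DifferentiableOn ℂ Θ {z : ℂ | 0 < z.im}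
  bounded : ∃ C : ℝ, ∀ z : ℂ, 0 < z.im → ‖Θ z‖ ≤ C
  unimodular : ∀ᵐ x : ℝ ∂volume, ‖Θ (x : ℂ)‖ = 1

/-- The spectrum of a meromorphic inner function: its level set at `1` on the real line. -/
def innerSpectrum (Θ : ℂ → ℂ) : Set ℝ := {x : ℝ | Θ (x : ℂ) = 1}

/-- A separated sequence of real numbers. The index type is arbitrary, which covers one-sided and
two-sided sequences; separation makes `s` injective. -/
def IsSeparatedSequence {ι : Type*} (s : ι → ℝ) : Prop :=
  ∃ ε : ℝ, 0 < ε ∧ ∀ n m : ι, n ≠ m → ε < |s n - s m|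

/-- The points `t 1 < ⋯ < t N` are consecutive points of the set `S`. -/
def AreConsecutivePoints (S : Set ℝ) (N : ℕ) (t : ℕ → ℝ) : Prop :=
  StrictMonoOn t (Icc 1 N) ∧ Icc (t 1) (t N) ∩ S = t '' Icc 1 N

/-- For every `N ≥ 2` there are `N` consecutive points of `S`, the first gap being longer than
`N * D` and all later gaps being shorter than `D`. -/
def HasClustersAfterGaps (S : Set ℝ) (D : ℝ) : Prop :=
  ∀ N : ℕ, 2 ≤ N → ∃ t : ℕ → ℝ, AreConsecutivePoints S N t ∧
    (N : ℝ) * D < t 2 - t 1 ∧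
    ∀ n : ℕ, 2 ≤ n → n + 1 ≤ N → t (n + 1) - t n < D

open Filter Topology Complex ComplexConjugate

/-! Suppose `Θ` has no zeros with `0 < Im z < δ`. By reflection (`reflection`) it is analytic and
zero-free for `|Im z| < δ`. Write `Θ = exp (iφ)` on `ℝ`; then `φ' ≥ 0` is `phaseDeriv`. Near each
real point, `log Θ` has real part of sign opposite to `Im z`. Rogosinski's transform turns this sign
condition into positivity of a real part, which gives `|φ''| ≤ (16/δ) φ'` and `|Θ(x+iy)| ≤ exp (-y
φ'(x)/4)` for small `y` (`local_estimates`). So `φ'` obeys a Harnack inequality. Across each gap of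
the spectrum `φ` grows by exactly `2π` (`integral_phaseDeriv_gap`). In a cluster the gaps are
shorter than `D`, so Harnack bounds `φ'` below near its points `a k`, and `|Θ|` decays at a definite
rate above them. Hence, for some `c > 0` independent of the cluster, `|Θ| ≤ exp (-c ∑ Im z / |z - a
k|²)` on small half-circles about the `a k`. The maximum principle extends this to the rest of the
half-plane, and on the real line it becomes `φ'(x) ≥ c ∑ 1/(x - a k)²`
(`mul_sum_inv_sq_le_phaseDeriv`). Integrated over the long gap, the right side exceeds a multiple of
a harmonic sum, up to a bounded error, while the left side is at most `2π`. Long clusters contradict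
this. Unboundedness of `Θ'` follows by the Schwarz lemma: a zero at height `y` forces `|Θ'| ≥ 1/y`
below it. -/

namespace IsMeromorphicInner

variable {Θ : ℂ → ℂ}

/-! ### Boundary regularity, reflection, and the derivative below a zero. -/

theorem analyticAt_of_im_pos (hΘ : IsMeromorphicInner Θ) {z : ℂ} (hz : 0 < z.im) :
    AnalyticAt ℂ Θ z :=
  hΘ.differentiableOn.analyticAt ((isOpen_lt continuous_const continuous_im).mem_nhds hz)

/-- A real pole would make `Θ` unbounded along the vertical approach from above; normal form then
turns nonnegative order into analyticity. -/
theorem analyticAt_ofReal (hΘ : IsMeromorphicInner Θ) (x : ℝ) : AnalyticAt ℂ Θ x := by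
  have hnf := hΘ.meromorphicNFOn (mem_univ (x : ℂ))
  rw [← hnf.meromorphicOrderAt_nonneg_iff_analyticAt]
  by_contra! hneg
  have hcob := tendsto_cobounded_of_meromorphicOrderAt_neg hneg
  obtain ⟨C, hC⟩ := hΘ.bounded
  have hpath : Tendsto (fun y : ℝ => (x : ℂ) + y * I) (𝓝[>] 0) (𝓝[≠] (x : ℂ)) := by
    refine tendsto_nhdsWithin_iff.2 ⟨?_, ?_⟩
    · refine Tendsto.mono_left ?_ nhdsWithin_le_nhds
      exact Continuous.tendsto' (by fun_prop) _ _ (by simp)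
    · filter_upwards [self_mem_nhdsWithin] with y hy h
      have := congrArg Complex.im h
      simp at this
      exact (ne_of_gt hy) this
  have hinf := tendsto_norm_cobounded_atTop.comp (hcob.comp hpath)
  obtain ⟨y, hy, hy0⟩ := ((hinf.eventually_gt_atTop C).and self_mem_nhdsWithin).exists
  exact absurd (hC (x + y * I) (by simpa using hy0)) (not_le.2 hy)

theorem analyticAt_of_im_nonneg (hΘ : IsMeromorphicInner Θ) {z : ℂ} (hz : 0 ≤ z.im) :
    AnalyticAt ℂ Θ z := by
  rcases hz.eq_or_lt with h | h
  · have : z = (z.re : ℂ) := Complex.ext (by simp) (by simp [← h])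
    rw [this]
    exact hΘ.analyticAt_ofReal _
  · exact hΘ.analyticAt_of_im_pos h

theorem norm_ofReal (hΘ : IsMeromorphicInner Θ) (x : ℝ) : ‖Θ x‖ = 1 := by
  have hc : Continuous fun x : ℝ => ‖Θ x‖ := by
    refine continuous_iff_continuousAt.2 fun y => ?_
    exact ((hΘ.analyticAt_ofReal y).continuousAt.comp
      (continuous_ofReal.continuousAt (x := y))).norm
  have := hc.ae_eq_iff_eq volume (g := fun _ => (1 : ℝ)) continuous_const |>.1 hΘ.unimodular
  exact congrFun this x

/-- Phragmén–Lindelöf in the right half-plane, after the rotation `w ↦ I * w`. -/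
theorem norm_le_one (hΘ : IsMeromorphicInner Θ) {z : ℂ} (hz : 0 ≤ z.im) : ‖Θ z‖ ≤ 1 := by
  obtain ⟨C, hC⟩ := hΘ.bounded
  have hmaps : ∀ w : ℂ, (I * w).im = w.re := fun w => by simp
  have hana : ∀ w : ℂ, 0 ≤ w.re → DifferentiableAt ℂ (fun w => Θ (I * w)) w := fun w hw =>
    ((hΘ.analyticAt_of_im_nonneg (by rwa [hmaps])).differentiableAt).comp w (by fun_prop)
  have key := PhragmenLindelof.right_half_plane_of_bounded_on_real (f := fun w => Θ (I * w))
    (C := 1) (z := -I * z) ?_ ?_ ?_ ?_ (by simpa using hz)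
  · simpa [← mul_assoc] using key
  · refine ⟨fun w hw => (hana w (le_of_lt hw)).differentiableWithinAt, fun w hw => ?_⟩
    refine (hana w ?_).continuousAt.continuousWithinAt
    have hcl : IsClosed {u : ℂ | 0 ≤ u.re} := isClosed_le continuous_const continuous_re
    have hsub : {u : ℂ | 0 < u.re} ⊆ {u : ℂ | 0 ≤ u.re} := fun u hu =>
      le_of_lt (show 0 < u.re from hu)
    exact closure_minimal hsub hcl hw
  · refine ⟨1, by norm_num, 0, ?_⟩
    refine Asymptotics.IsBigO.of_bound C ?_
    refine eventually_inf_principal.2 (Eventually.of_forall fun w hw => ?_)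
    simpa using hC (I * w) (by simpa [hmaps] using hw)
  · refine ⟨C, eventually_map.2 ?_⟩
    filter_upwards [eventually_gt_atTop 0] with x hx
    exact hC _ (by simpa using hx)
  · intro x
    have : I * (x * I) = ((-x : ℝ) : ℂ) := by
      push_cast
      linear_combination (x : ℂ) * I_mul_I
    simp only [this, hΘ.norm_ofReal, le_refl]

theorem mul_conj_ofReal (hΘ : IsMeromorphicInner Θ) (x : ℝ) :
    Θ x * conj (Θ (conj (x : ℂ))) = 1 := by
  rw [conj_ofReal, mul_conj, normSq_eq_norm_sq, hΘ.norm_ofReal]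
  simp

theorem analyticAt_conj_conj {f : ℂ → ℂ} {z : ℂ} (hf : AnalyticAt ℂ f (conj z)) :
    AnalyticAt ℂ (fun w => conj (f (conj w))) z := by
  rw [analyticAt_iff_eventually_differentiableAt] at hf ⊢
  have hc : Tendsto (fun w : ℂ => conj w) (𝓝 z) (𝓝 (conj z)) := continuous_conj.tendsto z
  filter_upwards [hc.eventually hf] with w hw
  have := (hw.hasDerivAt.conj_conj).differentiableAt
  simpa [Function.comp_def] using this

/-- Schwarz reflection: below a zero-free part of the upper half-plane the continuation is analytic
and given by reflection. -/
theorem reflection (hΘ : IsMeromorphicInner Θ) {δ : ℝ}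
    (hz : ∀ z : ℂ, 0 < z.im → z.im < δ → Θ z ≠ 0) {z : ℂ} (hz0 : z.im < 0) (hzδ : -δ < z.im) :
    AnalyticAt ℂ Θ z ∧ Θ z * conj (Θ (conj z)) = 1 := by
  have hgan : ∀ w : ℂ, w.im ≤ 0 → AnalyticAt ℂ (fun w => conj (Θ (conj w))) w := fun w hw =>
    analyticAt_conj_conj (hΘ.analyticAt_of_im_nonneg (by simpa using hw))
  have hgmer : ∀ w : ℂ, w.im ≤ 0 →
      MeromorphicAt (fun w => Θ w * conj (Θ (conj w)) - 1) w := fun w hw =>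
    (((hΘ.meromorphicNFOn (mem_univ w)).meromorphicAt).mul (hgan w hw).meromorphicAt).sub
      (MeromorphicAt.const 1 w)
  set V : Set ℂ := {w | w.im ≤ 0} with hV
  have hVc : IsPreconnected V := (convex_halfSpace_im_le 0).isPreconnected
  -- The reflection identity holds on `ℝ`, whose points accumulate at `0`; infinite order there then
  -- propagates through the connected closed lower half-plane.
  have htop0 : meromorphicOrderAt (fun w => Θ w * conj (Θ (conj w)) - 1) 0 = ⊤ := by
    by_contra hne
    have h1 := (meromorphicOrderAt_ne_top_iff_eventually_ne_zero (hgmer 0 (by simp))).1 hne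
    have hpath : Tendsto (fun x : ℝ => (x : ℂ)) (𝓝[>] 0) (𝓝[≠] (0 : ℂ)) := by
      refine tendsto_nhdsWithin_iff.2 ⟨?_, ?_⟩
      · refine Tendsto.mono_left ?_ nhdsWithin_le_nhds
        exact Continuous.tendsto' (by fun_prop) _ _ (by simp)
      · filter_upwards [self_mem_nhdsWithin] with y hy
        simpa using ne_of_gt hy
    obtain ⟨x, hx⟩ := (hpath.eventually h1).exists
    exact hx (by rw [hΘ.mul_conj_ofReal, sub_self])
  have htop : meromorphicOrderAt (fun w => Θ w * conj (Θ (conj w)) - 1) z = ⊤ := by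
    by_contra hne
    exact MeromorphicOn.meromorphicOrderAt_ne_top_of_isPreconnected (U := V)
      (fun w hw => hgmer w hw) hVc (x := z) (y := 0) (by simpa [hV] using hz0.le)
      (by simp [hV]) hne htop0
  rw [meromorphicOrderAt_eq_top_iff] at htop
  have hg0 : conj (Θ (conj z)) ≠ 0 := by
    have := hz (conj z) (by simpa using hz0) (by simpa using by linarith)
    simpa using this
  have hginv : AnalyticAt ℂ (fun w => (conj (Θ (conj w)))⁻¹) z := (hgan z hz0.le).inv hg0
  have hev : Θ =ᶠ[𝓝[≠] z] fun w => (conj (Θ (conj w)))⁻¹ := by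
    filter_upwards [htop] with w hw
    exact eq_inv_of_mul_eq_one_left (sub_eq_zero.1 hw)
  -- Normal form upgrades equality on a punctured neighbourhood to equality at `z` itself.
  have hev' := ((hΘ.meromorphicNFOn (mem_univ z)).eventuallyEq_nhdsNE_iff_eventuallyEq_nhds
    hginv.meromorphicNFAt).1 hev
  refine ⟨hginv.congr hev'.symm, ?_⟩
  rw [hev'.eq_of_nhds, inv_mul_cancel₀ hg0]

theorem analyticAt_and_ne_zero_of_strip (hΘ : IsMeromorphicInner Θ) {δ : ℝ}
    (hz : ∀ z : ℂ, 0 < z.im → z.im < δ → Θ z ≠ 0) {z : ℂ} (h : |z.im| < δ) :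
    AnalyticAt ℂ Θ z ∧ Θ z ≠ 0 := by
  obtain ⟨h1, h2⟩ := abs_lt.1 h
  rcases lt_trichotomy z.im 0 with h0 | h0 | h0
  · have := hΘ.reflection hz h0 h1
    exact ⟨this.1, left_ne_zero_of_mul_eq_one this.2⟩
  · refine ⟨hΘ.analyticAt_of_im_nonneg h0.ge, ?_⟩
    have : z = (z.re : ℂ) := Complex.ext (by simp) (by simp [h0])
    rw [this, ← norm_ne_zero_iff, hΘ.norm_ofReal]
    norm_num
  · exact ⟨hΘ.analyticAt_of_im_pos h0, hz z h0 h2⟩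

theorem one_le_norm_of_im_neg (hΘ : IsMeromorphicInner Θ) {δ : ℝ}
    (hz : ∀ z : ℂ, 0 < z.im → z.im < δ → Θ z ≠ 0) {z : ℂ} (hz0 : z.im < 0) (hzδ : -δ < z.im) :
    1 ≤ ‖Θ z‖ := by
  have h := congrArg norm (hΘ.reflection hz hz0 hzδ).2
  rw [norm_mul, RCLike.norm_conj, norm_one] at h
  have h1 : ‖Θ (conj z)‖ ≤ 1 := hΘ.norm_le_one (by simpa using hz0.le)
  nlinarith [norm_nonneg (Θ z), norm_nonneg (Θ (conj z))]

/-- A zero at height `y` forces the derivative to be at least `1 / y` below it. -/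
theorem one_le_im_mul_norm_deriv (hΘ : IsMeromorphicInner Θ) {z : ℂ} (hz : 0 < z.im)
    (h0 : Θ z = 0) : 1 ≤ z.im * ‖deriv Θ (z.re : ℂ)‖ := by
  have hball : ∀ w ∈ Metric.ball z z.im, 0 < w.im := fun w hw => by
    have h1 := (abs_im_le_norm (w - z)).trans_lt (mem_ball_iff_norm.1 hw)
    rw [sub_im, abs_lt] at h1
    linarith
  have hd := (hΘ.analyticAt_ofReal z.re).differentiableAt.hasDerivAt
  have hpath : HasDerivAt (fun y : ℝ => Θ (z.re + y * I)) (deriv Θ (z.re : ℂ) * I) 0 := by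
    have hin : HasDerivAt (fun y : ℝ => (z.re : ℂ) + y * I) I 0 := by
      simpa using ((hasDerivAt_id (0 : ℝ)).ofReal_comp.mul_const I).const_add (z.re : ℂ)
    exact HasDerivAt.comp (0 : ℝ) (h₂ := Θ) (by simpa using hd) hin
  have hslope := (hasDerivAt_iff_tendsto_slope_zero.1 hpath).norm.mono_left
    (nhdsWithin_mono (0 : ℝ) (s := Ioi 0) (fun y hy => ne_of_gt hy))
  have hle : 1 / z.im ≤ ‖deriv Θ (z.re : ℂ) * I‖ := by
    refine ge_of_tendsto hslope ?_
    filter_upwards [Ioo_mem_nhdsGT hz] with y hy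
    have hzy : (z.re + y * I : ℂ) - z = ((y - z.im : ℝ) : ℂ) * I :=
      Complex.ext (by simp) (by simp)
    have hdist : dist (z.re + y * I : ℂ) z = z.im - y := by
      rw [dist_eq_norm, hzy, norm_mul, norm_I, mul_one, norm_real, Real.norm_eq_abs,
        abs_of_neg (by linarith [hy.2])]
      ring
    -- Schwarz lemma on the disc about `z` tangent to the real axis: `|Θ(x+iy)| ≤ 1 - y / Im z`, so
    -- the vertical slope at the tangency point is at least `1 / Im z`.
    have hS := Complex.dist_le_div_mul_dist_of_mapsTo_ball (f := Θ) (c := z) (R₁ := z.im)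
      (R₂ := 1) (z := z.re + y * I)
      (fun w hw => (hΘ.analyticAt_of_im_pos (hball w hw)).differentiableAt.differentiableWithinAt)
      (fun w hw => by simpa [h0] using hΘ.norm_le_one (hball w hw).le)
      (by rw [Metric.mem_ball, hdist]; linarith [hy.1])
    rw [hdist, h0, dist_zero_right] at hS
    have h1 : 1 - ‖Θ (z.re + y * I)‖ ≤ ‖Θ (z.re + y * I) - Θ z.re‖ := by
      rw [← hΘ.norm_ofReal z.re, norm_sub_rev]
      exact norm_sub_norm_le _ _
    have h2 : 1 / z.im * (z.im - y) = 1 - y / z.im := by field_simp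
    simp only [zero_add, ofReal_zero, zero_mul, add_zero, norm_smul, norm_inv, Real.norm_eq_abs,
      abs_of_pos hy.1]
    rw [← div_eq_inv_mul, le_div_iff₀ hy.1]
    rw [h2] at hS
    have h3 : 1 / z.im * y = y / z.im := by ring
    linarith
  rw [norm_mul, norm_I, mul_one, div_le_iff₀ hz] at hle
  linarith

end IsMeromorphicInner

/-! ### Functions whose real part has the sign opposite to `Im z`. -/

/-- The maximum modulus principle for `exp (-p)`. -/
theorem re_nonneg_of_forall_mem_sphere {p : ℂ → ℂ} {c : ℂ} {ρ : ℝ} (hρ : 0 < ρ)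
    (hp : DiffContOnCl ℂ p (Metric.ball c ρ)) (hs : ∀ z ∈ Metric.sphere c ρ, 0 ≤ (p z).re)
    {z : ℂ} (hz : z ∈ Metric.closedBall c ρ) : 0 ≤ (p z).re := by
  have hd : DiffContOnCl ℂ (fun w => exp (-p w)) (Metric.ball c ρ) :=
    ⟨hp.differentiableOn.neg.cexp, hp.continuousOn.neg.cexp⟩
  have := Complex.norm_le_of_forall_mem_frontier_norm_le Metric.isBounded_ball hd (C := 1)
    (fun w hw => by
      rw [frontier_ball c hρ.ne'] at hw
      simpa [norm_exp] using hs w hw) (z := z) (by rwa [closure_ball c hρ.ne'])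
  simpa [norm_exp] using this

theorem norm_sub_le_of_re_nonneg {p : ℂ → ℂ} {ρ h : ℝ} (hp : DifferentiableOn ℂ p (Metric.ball 0 ρ))
    (hre : ∀ z ∈ Metric.ball (0 : ℂ) ρ, 0 ≤ (p z).re) (h0 : p 0 = h) {z : ℂ} (hz : ‖z‖ < ρ) :
    ‖p z - h‖ ≤ 2 * h * ‖z‖ / (ρ - ‖z‖) := by
  have hρ : 0 < ρ := (norm_nonneg z).trans_lt hz
  have hh : 0 ≤ h := by simpa [h0] using hre 0 (by simpa using hρ)
  -- Borel–Carathéodory for `h - p`; the slack `η` keeps the bound `h + η` strictly positive even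
  -- when `h = 0`.
  have key : ∀ η : ℝ, 0 < η → ‖p z - h‖ ≤ 2 * (h + η) * ‖z‖ / (ρ - ‖z‖) := fun η hη => by
    have := Complex.borelCaratheodory_zero (f := fun w => h - p w) (M := h + η) (R := ρ) (z := z)
      (by linarith) (by fun_prop) (fun w hw => by
        simpa using by linarith [hre w hw]) hρ (by simpa using hz) (by simp [h0])
    rwa [norm_sub_rev]
  have hlim : Tendsto (fun η : ℝ => 2 * (h + η) * ‖z‖ / (ρ - ‖z‖)) (𝓝[>] 0)
      (𝓝 (2 * h * ‖z‖ / (ρ - ‖z‖))) :=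
    (Continuous.tendsto' (by fun_prop) _ _ (by simp)).mono_left nhdsWithin_le_nhds
  exact ge_of_tendsto hlim (by filter_upwards [self_mem_nhdsWithin] with η hη using key η hη)

section TypicallyReal

variable {g : ℂ → ℂ} {R ρ h : ℝ}

/-- Rogosinski's transform of a function whose real part has the sign opposite to `Im z`. -/
theorem norm_rogosinski_sub_le (hg : DifferentiableOn ℂ g (Metric.ball 0 R)) (hρ : 0 < ρ)
    (hρR : ρ < R) (hsign : ∀ z ∈ Metric.ball (0 : ℂ) R, z.im * (g z).re ≤ 0) (h0 : g 0 = 0)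
    (hd : deriv g 0 = I * h) {z : ℂ} (hz : ‖z‖ < ρ) :
    ‖(1 - z ^ 2 / ρ ^ 2) * (-I * dslope g 0 z) - h‖ ≤ 2 * h * ‖z‖ / (ρ - ‖z‖) := by
  have hds : DifferentiableOn ℂ (dslope g 0) (Metric.ball 0 R) :=
    (Complex.differentiableOn_dslope (Metric.ball_mem_nhds _ (hρ.trans hρR))).2 hg
  set p : ℂ → ℂ := fun z => (1 - z ^ 2 / ρ ^ 2) * (-I * dslope g 0 z) with hp
  have hpd : DifferentiableOn ℂ p (Metric.ball 0 R) := by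
    have : DifferentiableOn ℂ (fun z : ℂ => 1 - z ^ 2 / (ρ : ℂ) ^ 2) (Metric.ball 0 R) := by
      fun_prop
    exact this.mul (hds.const_mul _)
  have hsub : Metric.closedBall (0 : ℂ) ρ ⊆ Metric.ball 0 R := Metric.closedBall_subset_ball hρR
  have hcl : DiffContOnCl ℂ p (Metric.ball 0 ρ) := by
    refine ⟨hpd.mono (Metric.ball_subset_closedBall.trans hsub), ?_⟩
    rw [closure_ball _ hρ.ne']
    exact (hpd.mono hsub).continuousOn
  have hsph : ∀ w ∈ Metric.sphere (0 : ℂ) ρ, 0 ≤ (p w).re := fun w hw => by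
    have hn : ‖w‖ = ρ := by simpa using hw
    have hw0 : w ≠ 0 := norm_ne_zero_iff.1 (hn ▸ hρ.ne')
    have hρc : (ρ : ℂ) ≠ 0 := by exact_mod_cast hρ.ne'
    have hsq : w * conj w = (ρ : ℂ) ^ 2 := by rw [mul_conj, normSq_eq_norm_sq, hn]; simp
    -- On `|w| = ρ`, `1 - w²/ρ² = w (conj w - w)/ρ²`, so the transform equals `g w` times a real
    -- factor of sign opposite to `Im w`.
    have hval : p w = ((-(2 * w.im / ρ ^ 2) : ℝ) : ℂ) * g w := by
      have hc : conj w - w = -(2 * w.im : ℝ) * I :=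
        Complex.ext (by simp) (by simp; ring)
      have h1 : (1 - w ^ 2 / (ρ : ℂ) ^ 2) = w * (conj w - w) / ρ ^ 2 := by
        field_simp
        linear_combination -hsq
      simp only [hp, h1, hc, dslope_of_ne _ hw0, slope_def_field, h0, sub_zero]
      push_cast
      field_simp
      linear_combination (w.im * g w) * I_sq
    rw [hval, re_ofReal_mul]
    have := hsign w (hsub (Metric.sphere_subset_closedBall hw))
    have h2 : -(2 * w.im / ρ ^ 2) * (g w).re = 2 / ρ ^ 2 * (-(w.im * (g w).re)) := by ring
    rw [h2]
    have : 0 ≤ -(w.im * (g w).re) := by linarith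
    positivity
  have hre : ∀ w ∈ Metric.ball (0 : ℂ) ρ, 0 ≤ (p w).re := fun w hw =>
    re_nonneg_of_forall_mem_sphere hρ hcl hsph (Metric.ball_subset_closedBall hw)
  refine norm_sub_le_of_re_nonneg (p := p) hcl.differentiableOn hre ?_ hz
  simp only [hp, dslope_same, hd]
  linear_combination (-(h : ℂ)) * I_sq

/-- With `g = z G`, `g''(0) = 2 G'(0)`. The factor `1 - z²/ρ²` is flat at `0`, so the transform has
derivative `-i G'(0)` there, and its oscillation bound on `|z| < ρ/2` gives `|G'(0)| ≤ 4h/ρ`. -/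
theorem norm_deriv_deriv_le_of_sign (hg : DifferentiableOn ℂ g (Metric.ball 0 R)) (hρ : 0 < ρ)
    (hρR : ρ < R) (hsign : ∀ z ∈ Metric.ball (0 : ℂ) R, z.im * (g z).re ≤ 0) (h0 : g 0 = 0)
    (hd : deriv g 0 = I * h) : ‖deriv (deriv g) 0‖ ≤ 8 / ρ * h := by
  have hnhds : Metric.ball (0 : ℂ) R ∈ 𝓝 (0 : ℂ) := Metric.ball_mem_nhds _ (hρ.trans hρR)
  have hds : DifferentiableOn ℂ (dslope g 0) (Metric.ball 0 R) :=
    (Complex.differentiableOn_dslope hnhds).2 hg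
  have hhnn : 0 ≤ h := by
    have := (norm_nonneg _).trans (norm_rogosinski_sub_le hg hρ hρR hsign h0 hd
      (z := (ρ / 2 : ℝ)) (by rw [norm_real, Real.norm_of_nonneg (by positivity)]; linarith))
    rw [norm_real, Real.norm_of_nonneg (by positivity)] at this
    have h3 : 2 * h * (ρ / 2) / (ρ - ρ / 2) = 2 * h := by field_simp; ring
    linarith
  have hG : HasDerivAt (dslope g 0) (deriv (dslope g 0) 0) 0 :=
    (hds.differentiableAt hnhds).hasDerivAt
  have hgeq : deriv g =ᶠ[𝓝 0] fun z => dslope g 0 z + z * deriv (dslope g 0) z := by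
    filter_upwards [Metric.isOpen_ball.mem_nhds (Metric.mem_ball_self (hρ.trans hρR))] with z hz
    have h1 : HasDerivAt (dslope g 0) (deriv (dslope g 0) z) z :=
      (hds.differentiableAt (Metric.isOpen_ball.mem_nhds hz)).hasDerivAt
    have h2 := (hasDerivAt_id z).mul h1
    have h3 : g = fun w => id w * dslope g 0 w := by
      funext w
      have := sub_smul_dslope g 0 w
      simpa [h0] using this.symm
    calc deriv g z = deriv (fun w => id w * dslope g 0 w) z := congrArg (fun f => deriv f z) h3
      _ = _ := by
        have h4 : HasDerivAt (fun w => id w * dslope g 0 w)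
          (1 * dslope g 0 z + id z * deriv (dslope g 0) z) z := h2
        rw [h4.deriv]; simp
  have hG' : DifferentiableAt ℂ (deriv (dslope g 0)) 0 :=
    ((hds.analyticAt hnhds).deriv).differentiableAt
  have h2 : deriv (deriv g) 0 = 2 * deriv (dslope g 0) 0 := by
    rw [hgeq.deriv_eq]
    have := hG.add ((hasDerivAt_id (0 : ℂ)).mul hG'.hasDerivAt)
    have h4 : HasDerivAt (fun z => dslope g 0 z + z * deriv (dslope g 0) z)
      (deriv (dslope g 0) 0 + (1 * deriv (dslope g 0) 0 + 0 * deriv (deriv (dslope g 0)) 0)) 0 :=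
      this
    rw [h4.deriv]
    ring
  have hpder : HasDerivAt (fun z : ℂ => (1 - z ^ 2 / (ρ : ℂ) ^ 2) * (-I * dslope g 0 z))
      (-I * deriv (dslope g 0) 0) 0 := by
    have h5 : HasDerivAt (fun z : ℂ => 1 - z ^ 2 / (ρ : ℂ) ^ 2) 0 0 := by
      simpa using (((hasDerivAt_id (0 : ℂ)).pow 2).div_const ((ρ : ℂ) ^ 2)).const_sub 1
    exact (h5.mul (hG.const_mul (-I))).congr_deriv (by simp)
  have hbound : ‖-I * deriv (dslope g 0) 0‖ ≤ 4 / ρ * h := by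
    refine hpder.le_of_lip' (by positivity) ?_
    filter_upwards [Metric.ball_mem_nhds (0 : ℂ) (half_pos hρ)] with z hz
    have hz' : ‖z‖ < ρ / 2 := by simpa using hz
    have h6 := norm_rogosinski_sub_le hg hρ hρR hsign h0 hd (z := z) (by linarith)
    have h7 : (1 - (0 : ℂ) ^ 2 / (ρ : ℂ) ^ 2) * (-I * dslope g 0 0) = h := by
      rw [dslope_same, hd]
      linear_combination (-(h : ℂ)) * I_sq
    rw [h7, sub_zero]
    refine h6.trans ?_
    rw [div_le_iff₀ (by linarith)]
    have h8 : 4 / ρ * h * ‖z‖ * (ρ - ‖z‖) = 2 * h * ‖z‖ * (2 * (ρ - ‖z‖) / ρ) := by ring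
    rw [h8]
    refine le_mul_of_one_le_right (by positivity) ?_
    rw [le_div_iff₀ hρ]
    linarith
  rw [norm_mul, norm_neg, norm_I, one_mul] at hbound
  rw [h2, norm_mul, show ‖(2 : ℂ)‖ = 2 by simp]
  calc 2 * ‖deriv (dslope g 0) 0‖ ≤ 2 * (4 / ρ * h) := by linarith
    _ = 8 / ρ * h := by ring

/-- At `iy` the transform is `-(1 + y²/ρ²)/y` times `g`, and for `y ≤ ρ/4` it lies within `2h/3` of
`h`. Dividing the resulting lower bound `h/3` by `4/3` gives the constant `1/4`. -/
theorem re_le_of_sign (hg : DifferentiableOn ℂ g (Metric.ball 0 R)) (hρ : 0 < ρ)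
    (hρR : ρ < R) (hsign : ∀ z ∈ Metric.ball (0 : ℂ) R, z.im * (g z).re ≤ 0) (h0 : g 0 = 0)
    (hd : deriv g 0 = I * h) (hh : 0 ≤ h) {y : ℝ} (hy : 0 < y) (hyρ : y ≤ ρ / 4) :
    (g (y * I)).re ≤ -(y * h / 4) := by
  have hn : ‖(y * I : ℂ)‖ = y := by simp [abs_of_pos hy]
  have hyc : (y : ℂ) ≠ 0 := by exact_mod_cast hy.ne'
  have key := norm_rogosinski_sub_le hg hρ hρR hsign h0 hd (z := y * I) (by rw [hn]; linarith)
  rw [hn] at key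
  have hval : (1 - (y * I : ℂ) ^ 2 / (ρ : ℂ) ^ 2) * (-I * dslope g 0 (y * I)) =
      ((-((1 + y ^ 2 / ρ ^ 2) / y) : ℝ) : ℂ) * g (y * I) := by
    have hne : (y * I : ℂ) ≠ 0 := mul_ne_zero hyc I_ne_zero
    rw [dslope_of_ne _ hne, slope_def_field, h0, sub_zero, sub_zero, mul_pow, I_sq]
    push_cast
    field_simp
    ring
  have hre := (abs_re_le_norm _).trans key
  rw [hval, sub_re, re_ofReal_mul, ofReal_re] at hre
  have h1 := (abs_le.1 hre).1
  have h2 : 2 * h * y / (ρ - y) ≤ 2 / 3 * h := by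
    rw [div_le_iff₀ (by linarith)]
    nlinarith
  set v := -(g (y * I)).re with hv
  have h3 : h / 3 ≤ (1 + y ^ 2 / ρ ^ 2) / y * v := by
    have : -((1 + y ^ 2 / ρ ^ 2) / y) * (g (y * I)).re = (1 + y ^ 2 / ρ ^ 2) / y * v := by
      rw [hv]; ring
    linarith
  have h4 : (1 + y ^ 2 / ρ ^ 2) ≤ 4 / 3 := by
    have : y ^ 2 / ρ ^ 2 ≤ 1 / 3 := by
      rw [div_le_iff₀ (by positivity)]
      nlinarith
    linarith
  have h5 : h / 3 * y ≤ (1 + y ^ 2 / ρ ^ 2) * v := by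
    calc h / 3 * y ≤ (1 + y ^ 2 / ρ ^ 2) / y * v * y := by gcongr
      _ = _ := by field_simp
  have hv0 : 0 ≤ v := by
    have : 0 < 1 + y ^ 2 / ρ ^ 2 := by positivity
    by_contra! hneg
    have := mul_neg_of_pos_of_neg this hneg
    have : 0 ≤ h / 3 * y := by positivity
    linarith
  have h6 : h / 3 * y ≤ 4 / 3 * v := h5.trans (by gcongr)
  linarith

end TypicallyReal

/-! ### The phase derivative on the real line. -/

/-- The upward derivative of `|f|²` at `x` is `-2 Im (f' conj (f x))`, and it cannot be positive. -/
theorem im_div_nonneg_of_norm_le_one {f : ℂ → ℂ} {f' : ℂ} {x : ℝ} (hf : HasDerivAt f f' x)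
    (hx : ‖f x‖ = 1) (hle : ∀ᶠ y : ℝ in 𝓝[>] 0, ‖f (x + y * I)‖ ≤ 1) : 0 ≤ (f' / f x).im := by
  have hin : HasDerivAt (fun y : ℝ => (x : ℂ) + y * I) I 0 := by
    simpa using ((hasDerivAt_id (0 : ℝ)).ofReal_comp.mul_const I).const_add (x : ℂ)
  have hpath : HasDerivAt (fun y : ℝ => f (x + y * I)) (f' * I) 0 :=
    HasDerivAt.comp (0 : ℝ) (h₂ := f) (by simpa using hf) hin
  have hslope := (hasDerivAt_iff_tendsto_slope_zero.1 hpath.norm_sq).mono_left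
    (nhdsWithin_mono (0 : ℝ) (s := Ioi 0) (fun y hy => ne_of_gt hy))
  have hle0 := le_of_tendsto hslope (b := 0) (by
    filter_upwards [hle, self_mem_nhdsWithin] with y hy hy0
    have hy0' : 0 < y := hy0
    simp only [zero_add, ofReal_zero, zero_mul, add_zero, hx, smul_eq_mul]
    refine mul_nonpos_of_nonneg_of_nonpos (by positivity) ?_
    have := pow_le_one₀ (n := 2) (norm_nonneg (f (x + y * I))) hy
    linarith)
  simp only [ofReal_zero, zero_mul, add_zero, Complex.inner] at hle0
  have hdiv : f' / f x = f' * conj (f x) := by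
    rw [div_eq_mul_inv, inv_def, normSq_eq_norm_sq, hx]
    simp
  rw [hdiv]
  simp at hle0 ⊢
  linarith

/-- The derivative of a continuous argument of `Θ` along the real line. -/
noncomputable def phaseDeriv (Θ : ℂ → ℂ) (x : ℝ) : ℝ := (deriv Θ x / Θ x).im

namespace IsMeromorphicInner

variable {Θ : ℂ → ℂ}

theorem ne_zero_ofReal (hΘ : IsMeromorphicInner Θ) (x : ℝ) : Θ x ≠ 0 := by
  rw [← norm_ne_zero_iff, hΘ.norm_ofReal]
  norm_num

theorem phaseDeriv_nonneg (hΘ : IsMeromorphicInner Θ) (x : ℝ) : 0 ≤ phaseDeriv Θ x := by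
  refine im_div_nonneg_of_norm_le_one (hΘ.analyticAt_ofReal x).differentiableAt.hasDerivAt
    (hΘ.norm_ofReal x) ?_
  filter_upwards [self_mem_nhdsWithin] with y hy
  exact hΘ.norm_le_one (by simpa using le_of_lt hy)

/-- The real part vanishes because `|Θ|²` is constant along `ℝ`. -/
theorem deriv_div_eq (hΘ : IsMeromorphicInner Θ) (x : ℝ) :
    deriv Θ x / Θ x = I * phaseDeriv Θ x := by
  have hpath : HasDerivAt (fun y : ℝ => Θ y) (deriv Θ x) x :=
    (hΘ.analyticAt_ofReal x).differentiableAt.hasDerivAt.comp_ofReal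
  have h1 := hpath.norm_sq
  have h2 : (fun y : ℝ => ‖Θ y‖ ^ 2) = fun _ => 1 := by
    funext y
    rw [hΘ.norm_ofReal, one_pow]
  rw [h2] at h1
  have h3 := h1.unique (hasDerivAt_const x (1 : ℝ))
  rw [Complex.inner] at h3
  have hdiv : deriv Θ x / Θ x = deriv Θ x * conj (Θ x) := by
    rw [div_eq_mul_inv, inv_def, normSq_eq_norm_sq, hΘ.norm_ofReal]
    simp
  refine Complex.ext ?_ (by simp [phaseDeriv])
  rw [hdiv]
  simp at h3 ⊢
  linarith

theorem continuous_phaseDeriv (hΘ : IsMeromorphicInner Θ) : Continuous (phaseDeriv Θ) := by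
  refine continuous_iff_continuousAt.2 fun x => ?_
  have hL : AnalyticAt ℂ (fun z => deriv Θ z / Θ z) x :=
    (hΘ.analyticAt_ofReal x).deriv.div (hΘ.analyticAt_ofReal x) (hΘ.ne_zero_ofReal x)
  exact continuous_im.continuousAt.comp
    (ContinuousAt.comp (f := fun y : ℝ => (y : ℂ)) hL.continuousAt continuous_ofReal.continuousAt)

theorem hasDerivAt_phaseDeriv (hΘ : IsMeromorphicInner Θ) (x : ℝ) :
    HasDerivAt (phaseDeriv Θ) (deriv (fun z => deriv Θ z / Θ z) x).im x := by
  have hL : AnalyticAt ℂ (fun z => deriv Θ z / Θ z) x :=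
    (hΘ.analyticAt_ofReal x).deriv.div (hΘ.analyticAt_ofReal x) (hΘ.ne_zero_ofReal x)
  exact (imCLM.hasFDerivAt.comp_hasDerivAt x hL.differentiableAt.hasDerivAt.comp_ofReal)

theorem eq_mul_exp_integral (hΘ : IsMeromorphicInner Θ) (a b : ℝ) :
    Θ b = Θ a * exp (I * ∫ x in a..b, phaseDeriv Θ x) := by
  set H : ℝ → ℝ := fun x => ∫ t in a..x, phaseDeriv Θ t with hH
  have hHd : ∀ x, HasDerivAt H (phaseDeriv Θ x) x := fun x =>
    intervalIntegral.integral_hasDerivAt_right (hΘ.continuous_phaseDeriv.intervalIntegrable _ _)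
      (hΘ.continuous_phaseDeriv.stronglyMeasurableAtFilter _ _) hΘ.continuous_phaseDeriv.continuousAt
  have hu : ∀ x : ℝ, HasDerivAt (fun x : ℝ => Θ x * exp (-(I * H x))) 0 x := fun x => by
    have h1 : HasDerivAt (fun y : ℝ => Θ y) (deriv Θ x) x :=
      (hΘ.analyticAt_ofReal x).differentiableAt.hasDerivAt.comp_ofReal
    have h2 := (((hHd x).ofReal_comp.const_mul I).neg).cexp
    refine (h1.mul h2).congr_deriv ?_
    have h3 : deriv Θ x = I * phaseDeriv Θ x * Θ x := by
      rw [← hΘ.deriv_div_eq, div_mul_cancel₀ _ (hΘ.ne_zero_ofReal x)]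
    rw [h3]
    simp only [Pi.neg_apply]
    ring
  have hconst := is_const_of_deriv_eq_zero (fun x => (hu x).differentiableAt)
    (fun x => (hu x).deriv) b a
  have hHa : H a = 0 := by simp [hH]
  simp only [hHa, ofReal_zero, mul_zero, neg_zero, exp_zero, mul_one] at hconst
  rw [← hconst, mul_assoc, ← exp_add]
  simp [hH]

/-- The phase `H` is nondecreasing from `0`, and `H b` is a multiple of `2π`. If `H b` were `0`,
then `Θ = 1` at the midpoint; if it exceeded `2π`, an interior point would have phase `2π`. -/
theorem integral_phaseDeriv_gap (hΘ : IsMeromorphicInner Θ) {a b : ℝ} (hab : a < b)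
    (ha : Θ a = 1) (hb : Θ b = 1) (hgap : ∀ x ∈ Ioo a b, Θ (x : ℂ) ≠ 1) :
    ∫ x in a..b, phaseDeriv Θ x = 2 * Real.pi := by
  set H : ℝ → ℝ := fun x => ∫ t in a..x, phaseDeriv Θ t with hH
  have hΘH : ∀ x : ℝ, Θ x = exp (I * H x) := fun x => by
    rw [hΘ.eq_mul_exp_integral a x, ha, one_mul]
  have hmono : ∀ x y, x ≤ y → H x ≤ H y := fun x y hxy => by
    have := intervalIntegral.integral_add_adjacent_intervals
      (hΘ.continuous_phaseDeriv.intervalIntegrable (μ := volume) a x)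
      (hΘ.continuous_phaseDeriv.intervalIntegrable x y)
    have h0 : 0 ≤ ∫ t in x..y, phaseDeriv Θ t :=
      intervalIntegral.integral_nonneg hxy fun t _ => hΘ.phaseDeriv_nonneg t
    simp only [hH]
    linarith
  have hcont : Continuous H := intervalIntegral.continuous_primitive
    (fun _ _ => hΘ.continuous_phaseDeriv.intervalIntegrable _ _) a
  have hHa : H a = 0 := by simp [hH]
  have hmem : ∀ x, H x = 0 ∨ H x = 2 * Real.pi → Θ x = 1 := fun x hx => by
    rw [hΘH]
    rcases hx with h | h
    · simp [h]
    · rw [h, ← exp_two_pi_mul_I]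
      congr 1
      push_cast
      ring
  have hpos : 0 < H b := by
    by_contra! hle
    have hm : a ≤ (a + b) / 2 ∧ (a + b) / 2 ≤ b := ⟨by linarith, by linarith⟩
    have h0 : H ((a + b) / 2) = 0 :=
      le_antisymm ((hmono _ _ hm.2).trans hle) (hHa ▸ hmono _ _ hm.1)
    exact hgap ((a + b) / 2) ⟨by linarith, by linarith⟩ (hmem _ (Or.inl h0))
  have hle : H b ≤ 2 * Real.pi := by
    by_contra! hlt
    obtain ⟨c, hc, hHc⟩ := intermediate_value_Ioo hab.le hcont.continuousOn
      (show 2 * Real.pi ∈ Ioo (H a) (H b) from ⟨by rw [hHa]; positivity, hlt⟩)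
    exact hgap c hc (hmem _ (Or.inr hHc))
  have hexp : exp (I * H b) = 1 := by rw [← hΘH, hb]
  obtain ⟨n, hn⟩ := exp_eq_one_iff.1 hexp
  have hn' : H b = n * (2 * Real.pi) := by
    have := congrArg Complex.im hn
    simpa using this
  have hpi : (0 : ℝ) < 2 * Real.pi := by positivity
  rw [hn'] at hpos hle
  have h1 : (0 : ℝ) < n := pos_of_mul_pos_left hpos hpi.le
  have h2 : (n : ℝ) ≤ 1 := by
    by_contra! h
    nlinarith
  have h3 : n = 1 := le_antisymm (by exact_mod_cast h2) (by exact_mod_cast h1)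
  change H b = _
  rw [hn', h3]
  simp

/-! ### Local estimates in a zero-free strip. -/

section Strip

variable {δ : ℝ}

/-- A logarithm of `Θ / Θ x` near a real point `x`. -/
theorem exists_log (hΘ : IsMeromorphicInner Θ)
    (hz : ∀ z : ℂ, 0 < z.im → z.im < δ → Θ z ≠ 0) (hδ : 0 < δ) (x : ℝ) :
    ∃ g : ℂ → ℂ, g 0 = 0 ∧
      (∀ z ∈ Metric.ball (0 : ℂ) δ, HasDerivAt g (deriv Θ (x + z) / Θ (x + z)) z) ∧
      ∀ z ∈ Metric.ball (0 : ℂ) δ, Θ (x + z) = Θ x * exp (g z) := by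
  have hstrip : ∀ z ∈ Metric.ball (0 : ℂ) δ, AnalyticAt ℂ Θ (x + z) ∧ Θ (x + z) ≠ 0 :=
    fun z hzb => hΘ.analyticAt_and_ne_zero_of_strip hz (by
      simpa using (abs_im_le_norm z).trans_lt (by simpa using hzb))
  have hd : DifferentiableOn ℂ (fun z => deriv Θ (x + z) / Θ (x + z)) (Metric.ball 0 δ) :=
    fun z hzb => by
      have := hstrip z hzb
      have h1 : DifferentiableAt ℂ (fun z => deriv Θ (x + z)) z :=
        DifferentiableAt.comp z (g := deriv Θ) this.1.deriv.differentiableAt (by fun_prop)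
      have h2 : DifferentiableAt ℂ (fun z => Θ (x + z)) z :=
        DifferentiableAt.comp z (g := Θ) this.1.differentiableAt (by fun_prop)
      exact (h1.div h2 this.2).differentiableWithinAt
  obtain ⟨G, hG⟩ := hd.isExactOn_ball
  have h0 : (0 : ℂ) ∈ Metric.ball (0 : ℂ) δ := Metric.mem_ball_self hδ
  refine ⟨fun z => G z - G 0, sub_self _, fun z hzb => (hG z hzb).sub_const _, fun z hzb => ?_⟩
  have hder : ∀ w ∈ Metric.ball (0 : ℂ) δ,
      HasDerivAt (fun w => Θ (x + w) * exp (-(G w - G 0))) 0 w := fun w hw => by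
    have h1 : HasDerivAt (fun w => Θ (x + w)) (deriv Θ (x + w)) w := by
      have := (hstrip w hw).1.differentiableAt.hasDerivAt
      exact this.comp_const_add (x : ℂ) w
    have h2 := (((hG w hw).sub_const (G 0)).neg).cexp
    refine (h1.mul h2).congr_deriv ?_
    have := (hstrip w hw).2
    simp only [Pi.neg_apply]
    field_simp
    ring
  have hconst := Metric.isOpen_ball.is_const_of_deriv_eq_zero
    (convex_ball (0 : ℂ) δ).isPreconnected
    (fun w hw => (hder w hw).differentiableAt.differentiableWithinAt)
    (fun w hw => (hder w hw).deriv) hzb h0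
  simp only [sub_self, neg_zero, exp_zero, mul_one, add_zero] at hconst
  rw [← hconst, mul_assoc, ← exp_add]
  simp

theorem local_estimates (hΘ : IsMeromorphicInner Θ)
    (hz : ∀ z : ℂ, 0 < z.im → z.im < δ → Θ z ≠ 0) (hδ : 0 < δ) (x : ℝ) :
    |(deriv (fun z => deriv Θ z / Θ z) x).im| ≤ 16 / δ * phaseDeriv Θ x ∧
      ∀ y : ℝ, 0 < y → y ≤ δ / 8 → ‖Θ (x + y * I)‖ ≤ Real.exp (-(y * phaseDeriv Θ x / 4)) := by
  obtain ⟨g, hg0, hgd, hgexp⟩ := hΘ.exists_log hz hδ x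
  have hnorm : ∀ z ∈ Metric.ball (0 : ℂ) δ, ‖Θ (x + z)‖ = Real.exp (g z).re := fun z hzb => by
    rw [hgexp z hzb, norm_mul, hΘ.norm_ofReal, one_mul, norm_exp]
  have hdiff : DifferentiableOn ℂ g (Metric.ball 0 δ) := fun z hzb =>
    (hgd z hzb).differentiableAt.differentiableWithinAt
  have h0 : (0 : ℂ) ∈ Metric.ball (0 : ℂ) δ := Metric.mem_ball_self hδ
  have hsign : ∀ z ∈ Metric.ball (0 : ℂ) δ, z.im * (g z).re ≤ 0 := fun z hzb => by
    have him := abs_lt.1 ((abs_im_le_norm z).trans_lt (by simpa using hzb))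
    rcases lt_or_ge z.im 0 with h | h
    · have h1 : 1 ≤ ‖Θ (x + z)‖ := hΘ.one_le_norm_of_im_neg hz (by simpa using h)
        (by simpa using him.1)
      rw [hnorm z hzb, Real.one_le_exp_iff] at h1
      exact mul_nonpos_of_nonpos_of_nonneg h.le h1
    · have h1 : ‖Θ (x + z)‖ ≤ 1 := hΘ.norm_le_one (by simpa using h)
      rw [hnorm z hzb, Real.exp_le_one_iff] at h1
      exact mul_nonpos_of_nonneg_of_nonpos h h1
  have hd0 : deriv g 0 = I * phaseDeriv Θ x := by
    rw [(hgd 0 h0).deriv, add_zero, hΘ.deriv_div_eq]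
  refine ⟨?_, fun y hy hyδ => ?_⟩
  -- Taking `ρ = δ/2` produces the constants `16/δ` here and `δ/8` in the decay estimate.
  · have h1 := norm_deriv_deriv_le_of_sign hdiff (half_pos hδ) (half_lt_self hδ) hsign hg0 hd0
    have h2 : deriv g =ᶠ[𝓝 0] fun z => (fun z => deriv Θ z / Θ z) (x + z) := by
      filter_upwards [Metric.isOpen_ball.mem_nhds h0] with z hzb using (hgd z hzb).deriv
    have h3 := h2.deriv_eq.trans
      (deriv_comp_const_add (fun z => deriv Θ z / Θ z) (x : ℂ) 0)
    rw [h3, add_zero] at h1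
    refine (abs_im_le_norm _).trans (h1.trans_eq ?_)
    ring
  · have hmem : (y * I : ℂ) ∈ Metric.ball (0 : ℂ) δ := by
      simp [abs_of_pos hy]
      linarith
    rw [hnorm _ hmem, Real.exp_le_exp]
    exact re_le_of_sign hdiff (half_pos hδ) (half_lt_self hδ) hsign hg0 hd0
      (hΘ.phaseDeriv_nonneg x) hy (by linarith)

/-- Harnack's inequality for the phase derivative. -/
theorem phaseDeriv_le (hΘ : IsMeromorphicInner Θ)
    (hz : ∀ z : ℂ, 0 < z.im → z.im < δ → Θ z ≠ 0) (hδ : 0 < δ) (x y : ℝ) :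
    phaseDeriv Θ y ≤ phaseDeriv Θ x * Real.exp (16 / δ * |y - x|) := by
  have hb := fun x => abs_le.1 (hΘ.local_estimates hz hδ x).1
  have hder : ∀ (c x : ℝ), HasDerivAt (fun x => phaseDeriv Θ x * Real.exp (c * x))
      (((deriv (fun z => deriv Θ z / Θ z) x).im + c * phaseDeriv Θ x) * Real.exp (c * x)) x :=
    fun c x => by
      refine ((hΘ.hasDerivAt_phaseDeriv x).mul
        (((hasDerivAt_id x).const_mul c).exp)).congr_deriv ?_
      simp only [id, mul_one]
      ring
  have hdf : ∀ c : ℝ, Differentiable ℝ fun x => phaseDeriv Θ x * Real.exp (c * x) :=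
    fun c x => (hder c x).differentiableAt
  -- The bound on the logarithmic derivative of the phase derivative makes its products with `exp
  -- (∓16x/δ)` monotone; each handles one ordering of `x` and `y`.
  have hanti : Antitone fun x => phaseDeriv Θ x * Real.exp (-(16 / δ) * x) := by
    refine antitone_of_deriv_nonpos (hdf _) fun x => ?_
    rw [(hder _ x).deriv]
    exact mul_nonpos_of_nonpos_of_nonneg (by linarith [(hb x).2]) (Real.exp_pos _).le
  have hmono : Monotone fun x => phaseDeriv Θ x * Real.exp (16 / δ * x) := by
    refine monotone_of_deriv_nonneg (hdf _) fun x => ?_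
    rw [(hder _ x).deriv]
    exact mul_nonneg (by linarith [(hb x).1]) (Real.exp_pos _).le
  have key : ∀ c : ℝ, phaseDeriv Θ y * Real.exp (c * y) ≤ phaseDeriv Θ x * Real.exp (c * x) →
      phaseDeriv Θ y ≤ phaseDeriv Θ x * Real.exp (c * x - c * y) := fun c h => by
    rw [Real.exp_sub, ← mul_div_assoc, le_div_iff₀ (Real.exp_pos _)]
    exact h
  rcases le_total x y with h | h
  · refine (key _ (hanti h)).trans_eq ?_
    rw [abs_of_nonneg (by linarith)]
    ring_nf
  · refine (key _ (hmono h)).trans_eq ?_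
    rw [abs_of_nonpos (by linarith)]
    ring_nf

end Strip

end IsMeromorphicInner

/-! ### Comparison with a sum of Poisson kernels. -/

/-- For `k ≠ j`, separation gives `|z - a k| ≥ 2r|k - j| - r ≥ r|k - j|`, so a convergent sum
independent of `n` dominates. -/
theorem exists_sum_inv_sq_le : ∃ S : ℝ, 0 < S ∧ ∀ (n : ℕ) (a : ℕ → ℝ) (r : ℝ), 0 < r →
    (∀ i < n, ∀ j < n, 2 * r * |(i : ℝ) - j| ≤ |a i - a j|) → ∀ (z : ℂ) (j : ℕ), j < n →
    ‖z - a j‖ = r → ∑ k ∈ Finset.range n, 1 / ‖z - a k‖ ^ 2 ≤ S / r ^ 2 := by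
  -- Since `1 / 0 ^ 2 = 0`, the indicator supplies the term `k = j`.
  set B : ℤ → ℝ := fun m => 1 / (m : ℝ) ^ 2 + if m = 0 then 1 else 0 with hB
  have hBs : Summable B := (Real.summable_one_div_int_pow.2 one_lt_two).add
    (hasSum_ite_eq (0 : ℤ) (1 : ℝ)).summable
  have hB0 : ∀ m, 0 ≤ B m := fun m => by
    simp only [hB]
    split_ifs <;> positivity
  refine ⟨∑' m, B m, ?_, fun n a r hr hsep z j hj hz => ?_⟩
  · exact hBs.tsum_pos hB0 0 (by simp [hB])
  have hterm : ∀ k ∈ Finset.range n, 1 / ‖z - a k‖ ^ 2 ≤ B ((k : ℤ) - j) / r ^ 2 := fun k hk => by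
    rcases eq_or_ne k j with rfl | hkj
    · simp [hB, hz]
    · have hm : (1 : ℝ) ≤ |(k : ℝ) - j| := by
        have : (1 : ℤ) ≤ |(k : ℤ) - j| := Int.one_le_abs (by omega)
        exact_mod_cast this
      have h1 : |a k - a j| ≤ ‖z - a k‖ + ‖z - a j‖ := by
        have := norm_sub_le (z - a j) (z - a k)
        rw [sub_sub_sub_cancel_left, ← ofReal_sub, norm_real, Real.norm_eq_abs] at this
        linarith
      have h2 := hsep k (Finset.mem_range.1 hk) j hj
      have h3 : r * |(k : ℝ) - j| ≤ ‖z - a k‖ := by nlinarith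
      have hne : ((k : ℤ) - j : ℤ) ≠ 0 := by omega
      simp only [hB, if_neg hne, add_zero, div_div]
      push_cast
      rw [← sq_abs ((k : ℝ) - j), ← mul_pow, mul_comm |(k : ℝ) - j|]
      exact one_div_le_one_div_of_le (by positivity) (by gcongr)
  refine (Finset.sum_le_sum hterm).trans ?_
  rw [← Finset.sum_div]
  gcongr
  have hinj : Function.Injective fun k : ℕ => (k : ℤ) - j := fun p q h => by
    simp at h
    exact h
  rw [← Finset.sum_image (f := B) (g := fun k : ℕ => (k : ℤ) - j) fun p _ q _ h => hinj h]
  exact hBs.sum_le_tsum _ fun m _ => hB0 m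

namespace IsMeromorphicInner

variable {Θ : ℂ → ℂ}

theorem norm_exp_sum_poisson (n : ℕ) (a : ℕ → ℝ) (c : ℝ) (z : ℂ) :
    ‖exp (c * I * ∑ k ∈ Finset.range n, 1 / (z - a k))‖ =
      Real.exp (c * ∑ k ∈ Finset.range n, z.im / ‖z - a k‖ ^ 2) := by
  rw [norm_exp, mul_assoc, re_ofReal_mul, I_mul_re, im_sum, ← Finset.sum_neg_distrib]
  congr 2
  refine Finset.sum_congr rfl fun k _ => ?_
  rw [one_div, inv_im, normSq_eq_norm_sq]
  simp [neg_div]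

/-- A comparison principle on the upper half-plane without finitely many half-discs. -/
theorem norm_mul_exp_le_one (hΘ : IsMeromorphicInner Θ) (n : ℕ) (a : ℕ → ℝ) {r c : ℝ}
    (hr : 0 < r) (hc : 0 ≤ c)
    (hcirc : ∀ z : ℂ, 0 ≤ z.im → ∀ j < n, ‖z - a j‖ = r →
      ‖Θ z * exp (c * I * ∑ k ∈ Finset.range n, 1 / (z - a k))‖ ≤ 1)
    {z : ℂ} (hz : 0 < z.im) (hza : ∀ k < n, r < ‖z - a k‖) :
    ‖Θ z * exp (c * I * ∑ k ∈ Finset.range n, 1 / (z - a k))‖ ≤ 1 := by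
  set f : ℂ → ℂ := fun z => Θ z * exp (c * I * ∑ k ∈ Finset.range n, 1 / (z - a k)) with hf
  obtain ⟨M, hM⟩ : ∃ M : ℝ, ∀ k < n, |a k| ≤ M := by
    refine ⟨∑ k ∈ Finset.range n, |a k|, fun k hk => ?_⟩
    exact Finset.single_le_sum (f := fun k => |a k|) (fun _ _ => abs_nonneg _)
      (Finset.mem_range.2 hk)
  -- Truncate to `|w| < R`. The frontier lies on the small circles, the real axis (where the
  -- exponential has modulus one) and the large arc, where each kernel is at most `1/(R - M)`; then
  -- `R → ∞`.
  have hR : ∀ R : ℝ, ‖z‖ < R → M < R → ‖f z‖ ≤ Real.exp (c * (n * (1 / (R - M)))) := by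
    intro R hzR hMR
    set U : Set ℂ := {w | 0 < w.im} ∩ {w | ‖w‖ < R} ∩
      ⋂ k ∈ Finset.range n, {w : ℂ | r < ‖w - a k‖} with hU
    set K : Set ℂ := {w | 0 ≤ w.im} ∩ {w | ‖w‖ ≤ R} ∩
      ⋂ k ∈ Finset.range n, {w : ℂ | r ≤ ‖w - a k‖} with hK
    have hUo : IsOpen U := ((isOpen_lt continuous_const continuous_im).inter
      (isOpen_lt continuous_norm continuous_const)).inter
      (isOpen_biInter_finset fun k _ => isOpen_lt continuous_const (by fun_prop))
    have hKc : IsClosed K := ((isClosed_le continuous_const continuous_im).inter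
      (isClosed_le continuous_norm continuous_const)).inter
      (isClosed_biInter fun k _ => isClosed_le continuous_const (by fun_prop))
    have hUK : U ⊆ K := by
      refine inter_subset_inter (inter_subset_inter (fun w hw => ?_) (fun w hw => ?_))
        (iInter₂_mono fun k _ w hw => ?_)
      · exact le_of_lt (show 0 < w.im from hw)
      · exact le_of_lt (show ‖w‖ < R from hw)
      · exact le_of_lt (show r < ‖w - a k‖ from hw)
    have hclK : closure U ⊆ K := closure_minimal hUK hKc
    have hKdiff : DifferentiableOn ℂ f K := fun w hw => by
      have h1 : DifferentiableAt ℂ Θ w := (hΘ.analyticAt_of_im_nonneg hw.1.1).differentiableAt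
      have h2 : DifferentiableAt ℂ (fun w : ℂ => ∑ k ∈ Finset.range n, 1 / (w - a k)) w := by
        refine DifferentiableAt.fun_sum fun k hk => ?_
        have h3 : r ≤ ‖w - a k‖ := mem_iInter₂.1 hw.2 k hk
        have h4 : w - a k ≠ 0 := norm_pos_iff.1 (hr.trans_le h3)
        exact (differentiableAt_const _).div (by fun_prop) h4
      exact (h1.mul (h2.const_mul _).cexp).differentiableWithinAt
    have hbdd : Bornology.IsBounded U := Metric.isBounded_ball.subset
      (fun w hw => mem_ball_zero_iff.2 hw.1.2 : U ⊆ Metric.ball 0 R)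
    have hzU : z ∈ U := ⟨⟨hz, hzR⟩, mem_iInter₂.2 fun k hk => hza k (Finset.mem_range.1 hk)⟩
    have hexp1 : 1 ≤ Real.exp (c * (n * (1 / (R - M)))) := by
      have : 0 < R - M := by linarith
      exact Real.one_le_exp (by positivity)
    refine Complex.norm_le_of_forall_mem_frontier_norm_le hbdd
      ((hKdiff.mono hclK).diffContOnCl) (fun w hw => ?_) (subset_closure hzU)
    rw [hUo.frontier_eq] at hw
    have hwK := hclK hw.1
    have him : 0 ≤ w.im := hwK.1.1
    have hfar : ∀ k < n, r ≤ ‖w - a k‖ := fun k hk =>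
      mem_iInter₂.1 hwK.2 k (Finset.mem_range.2 hk)
    by_cases hcase : ∃ j < n, ‖w - a j‖ = r
    · obtain ⟨j, hj, hjr⟩ := hcase
      exact (hcirc w him j hj hjr).trans hexp1
    push Not at hcase
    simp only [hf]
    rw [norm_mul, norm_exp_sum_poisson]
    rcases him.eq_or_lt with h0 | h0
    · simp only [← h0, zero_div, Finset.sum_const_zero, mul_zero, Real.exp_zero, mul_one]
      exact (hΘ.norm_le_one him).trans hexp1
    have hwR : ‖w‖ = R := by
      refine le_antisymm hwK.1.2 (le_of_not_gt fun hlt => hw.2 ⟨⟨h0, hlt⟩, ?_⟩)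
      exact mem_iInter₂.2 fun k hk => (hfar k (Finset.mem_range.1 hk)).lt_of_ne
        (hcase k (Finset.mem_range.1 hk)).symm
    rw [← one_mul (Real.exp (c * (n * _)))]
    refine mul_le_mul (hΘ.norm_le_one him) ?_ (Real.exp_pos _).le zero_le_one
    rw [Real.exp_le_exp]
    refine mul_le_mul_of_nonneg_left ?_ hc
    rw [← nsmul_eq_mul]
    refine (Finset.sum_le_card_nsmul _ _ (1 / (R - M)) fun k hk => ?_).trans_eq (by simp)
    have hk' := Finset.mem_range.1 hk
    have hpos : 0 < ‖w - a k‖ := hr.trans_le (hfar k hk')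
    have h1 : w.im ≤ ‖w - a k‖ := by
      have := (le_abs_self _).trans (abs_im_le_norm (w - a k))
      simpa using this
    have h2 : R - M ≤ ‖w - a k‖ := by
      have := norm_sub_norm_le w (a k)
      rw [norm_real, Real.norm_eq_abs, hwR] at this
      linarith [hM k hk']
    calc w.im / ‖w - a k‖ ^ 2 ≤ ‖w - a k‖ / ‖w - a k‖ ^ 2 := by gcongr
      _ = 1 / ‖w - a k‖ := by field_simp
      _ ≤ 1 / (R - M) := one_div_le_one_div_of_le (by linarith) h2
  have hlim : Tendsto (fun R : ℝ => Real.exp (c * (n * (1 / (R - M))))) atTop (𝓝 1) := by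
    have h1 : Tendsto (fun R : ℝ => 1 / (R - M)) atTop (𝓝 0) := by
      simp only [one_div]
      exact tendsto_inv_atTop_zero.comp (tendsto_atTop_add_const_right _ (-M) tendsto_id)
    have h2 := ((h1.const_mul (n : ℝ)).const_mul c)
    simpa [Function.comp_def] using (Real.continuous_exp.tendsto _).comp h2
  refine ge_of_tendsto hlim ?_
  filter_upwards [eventually_gt_atTop ‖z‖, eventually_gt_atTop M] with R h1 h2 using hR R h1 h2

/-- The comparison function has modulus one at `x` and at most one just above, so its logarithmic
derivative, `phaseDeriv` minus the sum, is nonnegative after division by `i`. -/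
theorem mul_sum_inv_sq_le_phaseDeriv (hΘ : IsMeromorphicInner Θ) (n : ℕ) (a : ℕ → ℝ) {r c : ℝ}
    (hr : 0 < r) (hc : 0 ≤ c)
    (hcirc : ∀ z : ℂ, 0 ≤ z.im → ∀ j < n, ‖z - a j‖ = r →
      ‖Θ z * exp (c * I * ∑ k ∈ Finset.range n, 1 / (z - a k))‖ ≤ 1)
    {x : ℝ} (hx : ∀ k < n, r < |x - a k|) :
    c * ∑ k ∈ Finset.range n, 1 / (x - a k) ^ 2 ≤ phaseDeriv Θ x := by
  have hne : ∀ k ∈ Finset.range n, ((x : ℂ) - a k) ≠ 0 := fun k hk => by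
    have := hr.trans (hx k (Finset.mem_range.1 hk))
    rw [← ofReal_sub]
    exact_mod_cast abs_pos.1 this
  have hsum : HasDerivAt (fun z : ℂ => ∑ k ∈ Finset.range n, 1 / (z - a k))
      (∑ k ∈ Finset.range n, -1 / ((x : ℂ) - a k) ^ 2) x := by
    refine HasDerivAt.fun_sum fun k hk => ?_
    simp only [one_div]
    exact ((hasDerivAt_id (x : ℂ)).sub_const (a k : ℂ)).inv (hne k hk)
  have hΘd := (hΘ.analyticAt_ofReal x).differentiableAt.hasDerivAt
  have hder := hΘd.mul (hsum.const_mul (c * I)).cexp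
  have hnorm : ‖Θ x * exp (c * I * ∑ k ∈ Finset.range n, 1 / ((x : ℂ) - a k))‖ = 1 := by
    rw [norm_mul, norm_exp_sum_poisson, hΘ.norm_ofReal]
    simp
  have key := im_div_nonneg_of_norm_le_one hder hnorm (by
    filter_upwards [self_mem_nhdsWithin] with y hy
    refine hΘ.norm_mul_exp_le_one n a hr hc hcirc (by simpa using hy) fun k hk => ?_
    refine (hx k hk).trans_le ?_
    have := abs_re_le_norm (x + y * I - a k : ℂ)
    simpa using this)
  have hval : (deriv Θ x * exp (c * I * ∑ k ∈ Finset.range n, 1 / ((x : ℂ) - a k)) +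
      Θ x * (exp (c * I * ∑ k ∈ Finset.range n, 1 / ((x : ℂ) - a k)) *
        (c * I * ∑ k ∈ Finset.range n, -1 / ((x : ℂ) - a k) ^ 2))) /
      (Θ x * exp (c * I * ∑ k ∈ Finset.range n, 1 / ((x : ℂ) - a k))) =
      deriv Θ x / Θ x - I * ((c * ∑ k ∈ Finset.range n, 1 / (x - a k) ^ 2 : ℝ) : ℂ) := by
    have h1 := hΘ.ne_zero_ofReal x
    have h2 := exp_ne_zero (c * I * ∑ k ∈ Finset.range n, 1 / ((x : ℂ) - a k))
    have h3 : ∑ k ∈ Finset.range n, -1 / ((x : ℂ) - a k) ^ 2 =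
        -∑ k ∈ Finset.range n, 1 / ((x : ℂ) - a k) ^ 2 := by
      rw [← Finset.sum_neg_distrib]
      exact Finset.sum_congr rfl fun k _ => neg_div _ _
    rw [h3]
    push_cast
    generalize exp (c * I * ∑ k ∈ Finset.range n, 1 / ((x : ℂ) - a k)) = e at *
    field_simp
    ring
  have key2 := (congrArg Complex.im hval) ▸ key
  rw [sub_im, I_mul_im, ofReal_re] at key2
  exact sub_nonneg.1 key2

end IsMeromorphicInner

/-! ### Clusters of level points and the long gap. -/

/-- Level points `b < a 0 < ⋯ < a n` of `Θ` without further ones in between, where `(b, a 0)` is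
long and the later gaps are short but separated. -/
structure IsLevelCluster (Θ : ℂ → ℂ) (D ε : ℝ) (n : ℕ) (b : ℝ) (a : ℕ → ℝ) : Prop where
  left : Θ b = 1
  mem : ∀ j ≤ n, Θ (a j) = 1
  long : (n + 2) * D < a 0 - b
  left_gap : ∀ x ∈ Ioo b (a 0), Θ (x : ℂ) ≠ 1
  gap : ∀ j < n, ∀ x ∈ Ioo (a j) (a (j + 1)), Θ (x : ℂ) ≠ 1
  short : ∀ j < n, a (j + 1) - a j < D
  separated : ∀ j < n, ε < a (j + 1) - a j

theorem exists_isLevelCluster {ι : Type*} {s : ι → ℝ} {D ε : ℝ} {Θ : ℂ → ℂ}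
    (hs : ∀ n m : ι, n ≠ m → ε < |s n - s m|) (hcl : HasClustersAfterGaps (range s) D)
    (hspec : innerSpectrum Θ = range s) (n : ℕ) :
    ∃ (b : ℝ) (a : ℕ → ℝ), IsLevelCluster Θ D ε n b a := by
  -- With `N = n + 2`, `t 1` is the isolated left point and `t 2, …, t (n + 2)` become `a 0, …, a
  -- n`, bounding `n` short gaps.
  obtain ⟨t, ⟨hmono, himg⟩, hlong, hshort⟩ := hcl (n + 2) (by omega)
  have hrange : ∀ k ∈ Icc 1 (n + 2), t k ∈ range s := fun k hk => by
    have : t k ∈ t '' Icc 1 (n + 2) := mem_image_of_mem t hk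
    rw [← himg] at this
    exact this.2
  have hone : ∀ k ∈ Icc 1 (n + 2), Θ (t k) = 1 := fun k hk => by
    have := hrange k hk
    rw [← hspec] at this
    exact this
  have hle : ∀ i ∈ Icc 1 (n + 2), ∀ j ∈ Icc 1 (n + 2), i ≤ j → t i ≤ t j := fun i hi j hj hij =>
    (hmono.le_iff_le hi hj).2 hij
  have hgap : ∀ k ∈ Icc 1 (n + 1), ∀ x ∈ Ioo (t k) (t (k + 1)), Θ (x : ℂ) ≠ 1 := by
    intro k hk x hx h1
    have hk1 : k ∈ Icc 1 (n + 2) := ⟨hk.1, hk.2.trans (by omega)⟩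
    have hk2 : k + 1 ∈ Icc 1 (n + 2) := ⟨by omega, by have := hk.2; omega⟩
    have hx1 : x ∈ range s := by
      rw [← hspec]
      exact h1
    have hx2 : x ∈ Icc (t 1) (t (n + 2)) :=
      ⟨(hle 1 ⟨le_rfl, by omega⟩ k hk1 hk.1).trans hx.1.le,
        hx.2.le.trans (hle (k + 1) hk2 (n + 2) ⟨by omega, le_rfl⟩ hk2.2)⟩
    have hx3 : x ∈ t '' Icc 1 (n + 2) := himg ▸ ⟨hx2, hx1⟩
    obtain ⟨m, hm, rfl⟩ := hx3
    have h2 := (hmono.lt_iff_lt hk1 hm).1 hx.1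
    have h3 := (hmono.lt_iff_lt hm hk2).1 hx.2
    omega
  refine ⟨t 1, fun j => t (j + 2), ⟨hone 1 ⟨le_rfl, by omega⟩, fun j hj => hone _ ⟨by omega, by omega⟩,
    by exact_mod_cast hlong, hgap 1 ⟨le_rfl, by omega⟩, fun j hj => ?_, fun j hj => ?_,
    fun j hj => ?_⟩⟩
  · have := hgap (j + 2) ⟨by omega, by omega⟩
    rwa [add_right_comm] at this
  · have := hshort (j + 2) (by omega) (by omega)
    rwa [add_right_comm] at this
  · have h1 : j + 2 ∈ Icc 1 (n + 2) := ⟨by omega, by omega⟩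
    have h2 : j + 1 + 2 ∈ Icc 1 (n + 2) := ⟨by omega, by omega⟩
    have hlt : t (j + 2) < t (j + 1 + 2) := hmono h1 h2 (by omega)
    obtain ⟨p, hp⟩ := hrange _ h1
    obtain ⟨q, hq⟩ := hrange _ h2
    have hne : q ≠ p := by
      rintro rfl
      linarith
    have := hs q p hne
    rwa [hp, hq, abs_of_pos (by linarith)] at this

namespace IsLevelCluster

variable {Θ : ℂ → ℂ} {D ε : ℝ} {n : ℕ} {b : ℝ} {a : ℕ → ℝ}

theorem mul_sub_le (h : IsLevelCluster Θ D ε n b a) {i j : ℕ} (hij : i ≤ j) (hj : j ≤ n) :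
    ε * ((j : ℝ) - i) ≤ a j - a i := by
  induction j, hij using Nat.le_induction with
  | base => simp
  | succ k hk ih =>
    have h1 := ih (by omega)
    have h2 := h.separated k (by omega)
    push_cast
    linarith

theorem mul_abs_sub_le (h : IsLevelCluster Θ D ε n b a) {i j : ℕ} (hi : i ≤ n) (hj : j ≤ n) :
    ε * |(i : ℝ) - j| ≤ |a i - a j| := by
  rcases le_total i j with hij | hij
  · have : (i : ℝ) ≤ j := by exact_mod_cast hij
    rw [abs_sub_comm, abs_of_nonneg (by linarith), abs_sub_comm]
    exact (h.mul_sub_le hij hj).trans (le_abs_self _)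
  · have : (j : ℝ) ≤ i := by exact_mod_cast hij
    rw [abs_of_nonneg (by linarith)]
    exact (h.mul_sub_le hij hi).trans (le_abs_self _)

theorem sub_zero_le (h : IsLevelCluster Θ D ε n b a) {j : ℕ} (hj : j ≤ n) :
    a j - a 0 ≤ j * D := by
  induction j with
  | zero => simp
  | succ k ih =>
    have h1 := ih (by omega)
    have h2 := h.short k (by omega)
    push_cast
    linarith

/-- In a zero-free strip the phase derivative is bounded below on the cluster. -/
theorem le_phaseDeriv (h : IsLevelCluster Θ D ε n b a) (hΘ : IsMeromorphicInner Θ) {δ : ℝ}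
    (hz : ∀ z : ℂ, 0 < z.im → z.im < δ → Θ z ≠ 0) (hδ : 0 < δ) (hD : 0 < D) (hε : 0 < ε)
    {j : ℕ} (hj : j < n) :
    2 * Real.pi / (D * Real.exp (16 / δ * D)) ≤ phaseDeriv Θ (a j) := by
  have hsep := h.separated j hj
  have hshort := h.short j hj
  have hlt : a j < a (j + 1) := by linarith
  have hint := hΘ.integral_phaseDeriv_gap hlt (h.mem j hj.le) (h.mem (j + 1) hj) (h.gap j hj)
  -- A gap shorter than `D` carries phase `2π`, and Harnack compares every value on it with the one
  -- at `a j`.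
  have hle : ∫ x in a j..a (j + 1), phaseDeriv Θ x ≤
      ∫ _ in a j..a (j + 1), phaseDeriv Θ (a j) * Real.exp (16 / δ * D) := by
    refine intervalIntegral.integral_mono_on hlt.le
      (hΘ.continuous_phaseDeriv.intervalIntegrable _ _) intervalIntegrable_const fun x hx => ?_
    refine (hΘ.phaseDeriv_le hz hδ (a j) x).trans ?_
    refine mul_le_mul_of_nonneg_left ?_ (hΘ.phaseDeriv_nonneg _)
    rw [Real.exp_le_exp]
    refine mul_le_mul_of_nonneg_left ?_ (by positivity)
    rw [abs_of_nonneg (by linarith [hx.1])]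
    linarith [hx.2]
  rw [hint, intervalIntegral.integral_const, smul_eq_mul] at hle
  rw [div_le_iff₀ (by positivity)]
  calc 2 * Real.pi ≤ (a (j + 1) - a j) * (phaseDeriv Θ (a j) * Real.exp (16 / δ * D)) := hle
    _ ≤ D * (phaseDeriv Θ (a j) * Real.exp (16 / δ * D)) := by
      have := hΘ.phaseDeriv_nonneg (a j)
      gcongr
    _ = _ := by ring

/-- Consequence of the comparison principle on the long gap to the left of the cluster. -/
theorem sum_le_of_forall_le_phaseDeriv (h : IsLevelCluster Θ D ε n b a)
    (hΘ : IsMeromorphicInner Θ) (hD : 0 < D) (hε : 0 < ε) {r c : ℝ} (hr : 0 < r) (hrD : r ≤ D)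
    (hc : 0 < c)
    (hlow : ∀ x : ℝ, (∀ k < n, r < |x - a k|) →
      c * ∑ k ∈ Finset.range n, 1 / (x - a k) ^ 2 ≤ phaseDeriv Θ x) :
    ∑ k ∈ Finset.range n, 1 / ((k : ℝ) + 1) ≤ 2 * (2 * Real.pi * D / c + 1) := by
  have hlong := h.long
  have hn : (0 : ℝ) ≤ n := Nat.cast_nonneg n
  have hnD : 0 ≤ n * D := by positivity
  -- Stopping at distance `2r` stays outside all the discs; `b ≤ e` because the gap exceeds `2D ≥
  -- 2r`.
  set e : ℝ := a 0 - 2 * r with he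
  have hbe : b ≤ e := by linarith
  have hba : b < a 0 := by linarith
  have hak : ∀ k < n, a 0 ≤ a k := fun k hk => by
    have := h.mul_sub_le (Nat.zero_le k) hk.le
    have h0 : 0 ≤ ε * ((k : ℝ) - (0 : ℕ)) := by simp; positivity
    linarith
  have hii : ∀ k ∈ Finset.range n,
      IntervalIntegrable (fun x => 1 / (x - a k) ^ 2) volume b e := fun k hk => by
    refine ContinuousOn.intervalIntegrable fun x hx => ?_
    rw [uIcc_of_le hbe] at hx
    have hne' : (x - a k) ^ 2 ≠ 0 := by
      refine pow_ne_zero 2 (ne_of_lt ?_)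
      have := hak k (Finset.mem_range.1 hk)
      have := hx.2
      linarith
    exact (ContinuousAt.div (f := fun _ => (1 : ℝ)) (g := fun x => (x - a k) ^ 2)
      continuousAt_const (by fun_prop) hne').continuousWithinAt
  have hintk : ∀ k < n, ∫ x in b..e, 1 / (x - a k) ^ 2 = 1 / (a k - e) - 1 / (a k - b) := by
    intro k hk
    have hder : ∀ x ∈ uIcc b e, HasDerivAt (fun x => 1 / (a k - x)) (1 / (x - a k) ^ 2) x := by
      intro x hx
      rw [uIcc_of_le hbe] at hx
      have hne : a k - x ≠ 0 := by
        have := hak k hk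
        have := hx.2
        linarith
      have hne' : (x - a k) ≠ 0 := by
        rw [← neg_sub]
        exact neg_ne_zero.2 hne
      simp only [one_div]
      refine (((hasDerivAt_id x).const_sub (a k)).inv hne).congr_deriv ?_
      simp only [id, neg_neg, one_div]
      rw [← neg_sub, neg_sq]
    exact intervalIntegral.integral_eq_sub_of_hasDerivAt hder (hii k (Finset.mem_range.2 hk))
  have hup : ∫ x in b..e, phaseDeriv Θ x ≤ 2 * Real.pi := by
    rw [← hΘ.integral_phaseDeriv_gap hba h.left (h.mem 0 (Nat.zero_le _)) h.left_gap,
      ← intervalIntegral.integral_add_adjacent_intervals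
        (hΘ.continuous_phaseDeriv.intervalIntegrable b e)
        (hΘ.continuous_phaseDeriv.intervalIntegrable e (a 0))]
    have : 0 ≤ ∫ x in e..a 0, phaseDeriv Θ x :=
      intervalIntegral.integral_nonneg (by linarith) fun x _ => hΘ.phaseDeriv_nonneg x
    linarith
  have hdown : c * ∑ k ∈ Finset.range n, (1 / (a k - e) - 1 / (a k - b)) ≤
      ∫ x in b..e, phaseDeriv Θ x := by
    rw [← Finset.sum_congr rfl fun k hk => hintk k (Finset.mem_range.1 hk),
      ← intervalIntegral.integral_finsetSum hii, ← intervalIntegral.integral_const_mul]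
    refine intervalIntegral.integral_mono_on hbe ?_
      (hΘ.continuous_phaseDeriv.intervalIntegrable _ _) fun x hx => hlow x fun k hk => ?_
    · exact (IntervalIntegrable.sum _ hii |>.congr (fun x _ => by simp)).const_mul c
    · have := hak k hk
      have := hx.2
      rw [abs_of_neg (by linarith)]
      linarith
  -- Here `a k - e ≤ kD + 2r ≤ 2(k+1)D` and `a k - b > (n+2)D`. The second terms then total at most
  -- `1/D`, which is why the long gap must grow with the cluster.
  have hterm : ∀ k ∈ Finset.range n, 1 / D * (1 / 2 * (1 / ((k : ℝ) + 1)) - 1 / (n + 2)) ≤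
      1 / (a k - e) - 1 / (a k - b) := fun k hk => by
    have hk' := Finset.mem_range.1 hk
    have h1 := hak k hk'
    have h2 := h.sub_zero_le hk'.le
    have hk0 : (0 : ℝ) ≤ k := Nat.cast_nonneg k
    have h3 : 1 / (2 * ((k : ℝ) + 1) * D) ≤ 1 / (a k - e) :=
      one_div_le_one_div_of_le (by linarith) (by nlinarith)
    have h4 : 1 / (a k - b) ≤ 1 / ((n + 2) * D) :=
      one_div_le_one_div_of_le (by positivity) (by linarith)
    have h5 : 1 / D * (1 / 2 * (1 / ((k : ℝ) + 1)) - 1 / (n + 2)) =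
        1 / (2 * ((k : ℝ) + 1) * D) - 1 / ((n + 2) * D) := by
      field_simp
    linarith
  have hsum := Finset.sum_le_sum hterm
  rw [← Finset.mul_sum, Finset.sum_sub_distrib, ← Finset.mul_sum, Finset.sum_const,
    Finset.card_range, nsmul_eq_mul] at hsum
  have hone : (n : ℝ) * (1 / (n + 2)) ≤ 1 := by
    rw [mul_one_div, div_le_one (by positivity)]
    linarith
  set H := ∑ k ∈ Finset.range n, 1 / ((k : ℝ) + 1)
  have hfin : c * (1 / D * (1 / 2 * H - 1)) ≤ 2 * Real.pi := by
    refine le_trans ?_ (hdown.trans hup)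
    refine mul_le_mul_of_nonneg_left (le_trans ?_ hsum) hc.le
    refine mul_le_mul_of_nonneg_left (by linarith) (by positivity)
  have : 1 / 2 * H - 1 ≤ 2 * Real.pi * D / c := by
    rw [le_div_iff₀ hc]
    calc (1 / 2 * H - 1) * c = c * (1 / D * (1 / 2 * H - 1)) * D := by field_simp
      _ ≤ 2 * Real.pi * D := by gcongr
  linarith

end IsLevelCluster

/-! ### The contradiction and the conclusion. -/

theorem IsMeromorphicInner.exists_zero_of_clusters {Θ : ℂ → ℂ} (hΘ : IsMeromorphicInner Θ)
    {D ε : ℝ} (hD : 0 < D) (hε : 0 < ε)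
    (hcl : ∀ n : ℕ, ∃ (b : ℝ) (a : ℕ → ℝ), IsLevelCluster Θ D ε n b a) {δ : ℝ} (hδ : 0 < δ) :
    ∃ z : ℂ, Θ z = 0 ∧ 0 < z.im ∧ z.im < δ := by
  by_contra! hno
  have hz : ∀ z : ℂ, 0 < z.im → z.im < δ → Θ z ≠ 0 := fun z h1 h2 h3 =>
    absurd (hno z h3 h1) (not_le.2 h2)
  obtain ⟨S, hS, hSle⟩ := exists_sum_inv_sq_le
  -- `ε/2` gives the separation `2r`, `δ/8` the vertical decay, and `D` the room in the long gap.
  set r : ℝ := min (min (ε / 2) (δ / 8)) D with hr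
  have hr0 : 0 < r := by positivity
  have hrε : r ≤ ε / 2 := (min_le_left _ _).trans (min_le_left _ _)
  have hrδ : r ≤ δ / 8 := (min_le_left _ _).trans (min_le_right _ _)
  have hrD : r ≤ D := min_le_right _ _
  -- `c₀` bounds the phase derivative at the cluster points; `c₁` allows for a Harnack shift by `r`
  -- and the decay factor `1/4`; `c` makes the kernel sum on the circles cost at most `c₁ * Im z`.
  -- None depends on `n`.
  set c₀ : ℝ := 2 * Real.pi / (D * Real.exp (16 / δ * D)) with hc₀
  set c₁ : ℝ := c₀ / Real.exp (16 / δ * r) / 4 with hc₁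
  set c : ℝ := c₁ * r ^ 2 / S with hc
  have hc₁0 : 0 < c₁ := by positivity
  have hc0 : 0 < c := by positivity
  have hbound : ∀ n : ℕ, ∑ k ∈ Finset.range n, 1 / ((k : ℝ) + 1) ≤
      2 * (2 * Real.pi * D / c + 1) := by
    intro n
    obtain ⟨b, a, h⟩ := hcl n
    refine h.sum_le_of_forall_le_phaseDeriv hΘ hD hε hr0 hrD hc0 fun x hx => ?_
    refine hΘ.mul_sum_inv_sq_le_phaseDeriv n a hr0 hc0.le (fun z hzim j hj hzj => ?_) hx
    rw [norm_mul, norm_exp_sum_poisson]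
    rcases hzim.eq_or_lt with h0 | h0
    · simpa [← h0] using hΘ.norm_le_one hzim
    have hsum := hSle n a r hr0 (fun i hi j hj =>
      (mul_le_mul_of_nonneg_right (by linarith) (abs_nonneg _)).trans
        (h.mul_abs_sub_le hi.le hj.le)) z j hj hzj
    have hyr : z.im ≤ r := by
      have := (le_abs_self _).trans (abs_im_le_norm (z - a j))
      simpa [hzj] using this
    have hxr : |a j - z.re| ≤ r := by
      have := abs_re_le_norm (z - a j)
      rw [hzj, sub_re, ofReal_re] at this
      rwa [abs_sub_comm]
    have hph : c₀ ≤ phaseDeriv Θ z.re * Real.exp (16 / δ * r) := by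
      refine (h.le_phaseDeriv hΘ hz hδ hD hε hj).trans
        ((hΘ.phaseDeriv_le hz hδ z.re (a j)).trans ?_)
      refine mul_le_mul_of_nonneg_left ?_ (hΘ.phaseDeriv_nonneg _)
      rw [Real.exp_le_exp]
      exact mul_le_mul_of_nonneg_left hxr (by positivity)
    have hph' : c₁ ≤ phaseDeriv Θ z.re / 4 := by
      rw [hc₁]
      gcongr
      rwa [div_le_iff₀ (Real.exp_pos _)]
    have hΘz := (hΘ.local_estimates hz hδ z.re).2 z.im h0 (hyr.trans hrδ)
    rw [re_add_im] at hΘz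
    have hexp : c * ∑ k ∈ Finset.range n, z.im / ‖z - a k‖ ^ 2 ≤ z.im * c₁ := by
      calc c * ∑ k ∈ Finset.range n, z.im / ‖z - a k‖ ^ 2
          = c * (z.im * ∑ k ∈ Finset.range n, 1 / ‖z - a k‖ ^ 2) := by
            rw [Finset.mul_sum (f := fun k => 1 / ‖z - a k‖ ^ 2)]
            simp only [mul_one_div]
        _ ≤ c * (z.im * (S / r ^ 2)) := by gcongr
        _ = z.im * c₁ := by
            rw [hc]
            field_simp
    calc ‖Θ z‖ * Real.exp (c * ∑ k ∈ Finset.range n, z.im / ‖z - a k‖ ^ 2)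
        ≤ Real.exp (-(z.im * phaseDeriv Θ z.re / 4)) * Real.exp (z.im * c₁) := by gcongr
      _ ≤ 1 := by
        rw [← Real.exp_add, Real.exp_le_one_iff]
        nlinarith
  obtain ⟨n, hn⟩ := (Real.tendsto_sum_range_one_div_nat_succ_atTop.eventually_gt_atTop
    (2 * (2 * Real.pi * D / c + 1))).exists
  exact absurd (hbound n) (not_le.2 hn)

theorem mainTheorem4 {ι : Type*} (s : ι → ℝ) (hs : IsSeparatedSequence s)
    (D : ℝ) (hD : 0 < D) (hclusters : HasClustersAfterGaps (Set.range s) D)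
    (Θ : ℂ → ℂ) (hΘ : IsMeromorphicInner Θ) (hspec : innerSpectrum Θ = Set.range s) :
    (∀ δ : ℝ, 0 < δ → ∃ z : ℂ, Θ z = 0 ∧ 0 < z.im ∧ z.im < δ) ∧
      ¬ BddAbove (Set.range fun x : ℝ => ‖deriv Θ (x : ℂ)‖) := by
  obtain ⟨ε, hε, hsep⟩ := hs
  have hzeros : ∀ δ : ℝ, 0 < δ → ∃ z : ℂ, Θ z = 0 ∧ 0 < z.im ∧ z.im < δ := fun δ hδ =>
    hΘ.exists_zero_of_clusters hD hε (exists_isLevelCluster hsep hclusters hspec) hδ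
  refine ⟨hzeros, fun ⟨M, hM⟩ => ?_⟩
  have hbd : ∀ x : ℝ, ‖deriv Θ (x : ℂ)‖ ≤ M := fun x => hM (mem_range_self x)
  have hM0 : 0 ≤ M := (norm_nonneg _).trans (hbd 0)
  obtain ⟨z, h0, hpos, hlt⟩ := hzeros (1 / (M + 1)) (by positivity)
  have h1 := hΘ.one_le_im_mul_norm_deriv hpos h0
  rw [lt_div_iff₀ (by positivity)] at hlt
  nlinarith [mul_le_mul_of_nonneg_left (hbd z.re) hpos.le]
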